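/- **Setting.** Let $\gamma_1,\dots,\gamma_r$ be simple piecewise $C^1$ regular arcs in $\mathbb C$, bounded or unbounded, each parametrized by $\mathbb R$ (for instance all equal to the real line), and let $d\mu_k(z)=w_k(z)\,dz$ on $\gamma_k$, where the weight $w_k$ may be complex valued, is continuous along $\gamma_k$, tends to $0$ at both ends of $\gamma_k$, and all moments $\int z^m w_k(z)\,dz$ converge absolutely. The set of parameters where $w_k\neq0$ has an at most countable boundary; thus $\operatorname{supp}\mu_k$ consists of arcs, and $w_k$ vanishes at their endpoints. Where $w_k\ne 0$ on $\gamma_k$, let $v_k=-\ln w_k$ (a branch, $e^{-v_k}=w_k$) be differentiable along the set $\{w_k\neq 0\}\subset\gamma_k$ with derivative $v_k'$; at the other points $x\in\mathbb C$, $v_k'(x)$ is the value of an arbitrary fixed extension of $v_k'$ (for instance an analytic continuation). Integrals $\int\cdot\,w_k(t)\,dt$ are along $\gamma_k$. For $\vec n\in\mathbb N^r$ ($0\in\mathbb N$) put $|\vec n|=n_1+\dots+n_r$. The index $\vec n$ is normal if the $|\vec n|\times|\vec n|$ matrix of mixed moments, whose $j$-th block has the columns $\big(\int z^{a+l}d\mu_j\big)_{0\le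 a<|\vec n|}$, $0\le l<n_j$, is nonsingular. Let $P_{\vec n}$ be the type II polynomial: monic of degree $|\vec n|$ with $\int P_{\vec n}(t)t^l\,d\mu_j(t)=0$ for $0\le l<n_j$, $1\le j\le r$. Let $(A_{\vec n,1},\dots,A_{\vec n,r})$ be the type I vector: $\deg A_{\vec n,j}\le n_j-1$ ($A_{\vec n,j}=0$ if $n_j=0$), $\sum_j\int t^lA_{\vec n,j}\,d\mu_j=0$ for $0\le l\le|\vec n|-2$, and $\sum_j\int t^{|\vec n|-1}A_{\vec n,j}\,d\mu_j=1$ if $|\vec n|\ge1$. Put $$a_{\vec n,j}=\frac{\int t^{n_j}P_{\vec n}\,d\mu_j}{\int t^{n_j-1}P_{\vec n-\vec e_j}\,d\mu_j}\quad(n_j\ge 1),$$ and $a_{\vec n,j}=0$, $P_{\vec n-\vec e_j}=0$ if $n_j=0$; also $\vec e_0=\vec 0$. **Theorem 2.1.** Suppose that all multi-indices are normal. Let $\vec n\in\mathbb N^r$ be such that the functions $x^lw_k$, $1\le k\le r$, $0\le l<n_k$ (extended by $0$ off $\gamma_k$), are linearly independent. For $x\in\mathbb C$, $0\le i\le r$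 and $0\le j\le r$ put $$I_{ij}(x)=\sum_{k=1}^r\int P_{\vec n-\vec e_i}(t)\,A_{\vec n+\vec e_j,k}(t)\,\frac{v_k'(t)-v_k'(x)}{x-t}\,w_k(t)\,dt .$$ 1. If the integrals in $I_{0j}(x)$, $0\le j\le r$, converge absolutely, then $$P_{\vec n}'(x)=P_{\vec n}(x)\,I_{00}(x)-\sum_{j=1}^r a_{\vec n,j}P_{\vec n-\vec e_j}(x)\,I_{0j}(x).$$ 2. For each $i=1,\dots,r$, if the integrals in $I_{ij}(x)$, $0\le j\le r$, converge absolutely, then $$P_{\vec n-\vec e_i}'(x)=P_{\vec n}(x)\,I_{i0}(x)-\sum_{j=1}^r\big(a_{\vec n,j}I_{ij}(x)-v_i'(x)\delta_{i,j}\big)P_{\vec n-\vec e_j}(x).$$ 3. If all these integrals converge absolutely, then $\mathbf P_{\vec n}'(x)=N(x)\mathbf P_{\vec n}(x)$, where $\mathbf P_{\vec n}=(P_{\vec n},P_{\vec n-\vec e_1},\dots,P_{\vec n-\vec e_r})^T$ and $N=(N_{ij})_{0\le i,j\le r}$ has the entries $$N_{i0}(x)=\sum_{k=1}^r\int P_{\vec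 n-\vec e_i}(t)A_{\vec n,k}(t)\frac{v_k'(t)-v_k'(x)}{x-t}w_k(t)\,dt,$$ $$N_{ij}(x)=a_{\vec n,j}\sum_{k=1}^r\int P_{\vec n-\vec e_i}(t)A_{\vec n+\vec e_j,k}(t)\frac{v_k'(t)-v_k'(x)}{t-x}w_k(t)\,dt+v_i'(x)\delta_{i,j}\quad(j\ge1).$$ -/

import Mathlib

open Polynomial

namespace MultipleOrthogonal

/-- A simple, piecewise continuously differentiable, regular open arc in the complex plane
(bounded or not), parametrized by the real line. On each bounded parameter interval there are
only finitely many corners. -/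
structure IsSimpleCurve (γ : ℝ → ℂ) : Prop where
  continuous : Continuous γ
  injective : Function.Injective γ
  piecewise_smooth : ∃ F : Set ℝ, (∀ a b : ℝ, (F ∩ Set.Icc a b).Finite) ∧
    ∀ s ∉ F, ContDiffAt ℝ 1 γ s ∧ deriv γ s ≠ 0

/-- Absolute convergence of the contour integral of `f` along `γ`. -/
def CurveIntegrable (γ : ℝ → ℂ) (f : ℂ → ℂ) : Prop :=
  MeasureTheory.Integrable (fun s : ℝ => f (γ s) * deriv γ s)

/-- The contour integral of `f` along `γ`. -/
noncomputable def curveIntegral (γ : ℝ → ℂ) (f : ℂ → ℂ) : ℂ :=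
  ∫ s : ℝ, f (γ s) * deriv γ s

/-- The points of the curve at which the weight does not vanish; the closure of this set is the
support of the measure `w(z) dz` on the curve. -/
def nonvanishingSet (γ : ℝ → ℂ) (w : ℂ → ℂ) : Set ℂ :=
  {z | z ∈ Set.range γ ∧ w z ≠ 0}

/-- `w` is a (possibly complex) weight on the simple curve `γ`, with finite moments, continuous
along the curve and tending to zero at both ends of it. The support of `w(z) dz` may be smaller
than the curve: it is made up of arcs with at most countably many endpoints, and at each of
those `w` vanishes (by continuity, if the endpoint is on the curve). Where `w` does not vanish, `v`
is a branch of `-log w`, and `v'` is the derivative of `v` along the curve. Nothing is required of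
the values of `w`, `v` and `v'` at other points. -/
structure IsVanishingWeight (γ : ℝ → ℂ) (w v v' : ℂ → ℂ) : Prop where
  curve : IsSimpleCurve γ
  moments : ∀ m : ℕ, CurveIntegrable γ (fun t => t ^ m * w t)
  continuous : Continuous (fun s : ℝ => w (γ s))
  vanish_left : Filter.Tendsto (fun s : ℝ => w (γ s)) Filter.atBot (nhds 0)
  vanish_right : Filter.Tendsto (fun s : ℝ => w (γ s)) Filter.atTop (nhds 0)
  endpoints : (frontier {s : ℝ | w (γ s) ≠ 0}).Countable
  neg_log : ∀ z ∈ nonvanishingSet γ w, Complex.exp (-v z) = w z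
  hasDeriv : ∀ z ∈ nonvanishingSet γ w, HasDerivWithinAt v (v' z) (nonvanishingSet γ w) z

variable {r : ℕ}

/-- The moment of order `m` of the measure with weight `w` on `γ`. -/
noncomputable def moment (γ : ℝ → ℂ) (w : ℂ → ℂ) (m : ℕ) : ℂ :=
  curveIntegral γ (fun t => t ^ m * w t)

/-- The square matrix of mixed moments of size `|n|`. The columns are grouped in `r` blocks; the
`l`-th column of the `j`-th block (`0 ≤ l < n j`) has the moment of order `a + l` of the `j`-th
measure in row `a`. -/
noncomputable def mixedMomentMatrix (γ : Fin r → ℝ → ℂ) (w : Fin r → ℂ → ℂ) (n : Fin r → ℕ) :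
    Matrix (Fin (∑ j, n j)) (Fin (∑ j, n j)) ℂ :=
  Matrix.of fun a b =>
    moment (γ (finSigmaFinEquiv.symm b).1) (w (finSigmaFinEquiv.symm b).1)
      ((a : ℕ) + ((finSigmaFinEquiv.symm b).2 : ℕ))

/-- A multi-index is normal if its matrix of mixed moments is not singular. -/
def IsNormalIndex (γ : Fin r → ℝ → ℂ) (w : Fin r → ℂ → ℂ) (n : Fin r → ℕ) : Prop :=
  (mixedMomentMatrix γ w n).det ≠ 0

/-- `p` is the type II multiple orthogonal polynomial of the multi-index `n`. -/
structure IsTypeII (γ : Fin r → ℝ → ℂ) (w : Fin r → ℂ → ℂ) (n : Fin r → ℕ) (p : ℂ[X]) : Prop where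
  monic : p.Monic
  natDegree : p.natDegree = ∑ j, n j
  orthogonal : ∀ j : Fin r, ∀ l < n j, curveIntegral (γ j) (fun t => p.eval t * t ^ l * w j t) = 0

/-- `A` is the vector of type I multiple orthogonal polynomials of the multi-index `n`; the `j`-th
polynomial has degree at most `n j - 1`, and is zero if `n j = 0`. -/
structure IsTypeI (γ : Fin r → ℝ → ℂ) (w : Fin r → ℂ → ℂ) (n : Fin r → ℕ) (A : Fin r → ℂ[X]) :
    Prop where
  degree : ∀ j, (A j).degree < (n j : WithBot ℕ)
  orthogonal : ∀ l : ℕ, l + 1 < ∑ j, n j →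
    ∑ j, curveIntegral (γ j) (fun t => t ^ l * (A j).eval t * w j t) = 0
  normalized : ∀ l : ℕ, l + 1 = ∑ j, n j →
    ∑ j, curveIntegral (γ j) (fun t => t ^ l * (A j).eval t * w j t) = 1

/-- The polynomial with multi-index `n - e_i`, where `e_0 = 0` (the index `0` is `none`). If
`n i = 0` then `n - e_i` is not a multi-index and the polynomial is `0` by convention. -/
noncomputable def lowered (P : (Fin r → ℕ) → ℂ[X]) (n : Fin r → ℕ) : Option (Fin r) → ℂ[X]
  | none => P n
  | some i => if n i = 0 then 0 else P (n - Pi.single i 1)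

/-- The vector with multi-index `n + e_j`, where `e_0 = 0` (the index `0` is `none`). -/
def raised (A : (Fin r → ℕ) → Fin r → ℂ[X]) (n : Fin r → ℕ) : Option (Fin r) → Fin r → ℂ[X]
  | none => A n
  | some j => A (n + Pi.single j 1)

/-- The nearest-neighbor recurrence coefficient `a_{n,j}`, which is `0` if `n j = 0`. -/
noncomputable def recurrenceCoeff (γ : Fin r → ℝ → ℂ) (w : Fin r → ℂ → ℂ)
    (P : (Fin r → ℕ) → ℂ[X]) (n : Fin r → ℕ) (j : Fin r) : ℂ :=
  if n j = 0 then 0 else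
    curveIntegral (γ j) (fun t => t ^ (n j) * (P n).eval t * w j t) /
      curveIntegral (γ j) (fun t => t ^ (n j - 1) * (P (n - Pi.single j 1)).eval t * w j t)

/-- `∑ₖ ∫ p(t) Bₖ(t) (vₖ'(t) - vₖ'(x)) / (x - t) wₖ(t) dt`, the `k`-th integral being over the
`k`-th curve. -/
noncomputable def ladderIntegral (γ : Fin r → ℝ → ℂ) (w v' : Fin r → ℂ → ℂ) (p : ℂ[X])
    (B : Fin r → ℂ[X]) (x : ℂ) : ℂ :=
  ∑ k, curveIntegral (γ k)
    (fun t => p.eval t * ((B k).eval t * ((v' k t - v' k x) / (x - t)) * w k t))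

/-- All the integrals in `ladderIntegral` converge absolutely. -/
def LadderIntegrable (γ : Fin r → ℝ → ℂ) (w v' : Fin r → ℂ → ℂ) (p : ℂ[X])
    (B : Fin r → ℂ[X]) (x : ℂ) : Prop :=
  ∀ k, CurveIntegrable (γ k)
    (fun t => p.eval t * ((B k).eval t * ((v' k t - v' k x) / (x - t)) * w k t))

/-- The `(r + 1) × (r + 1)` ladder matrix `N(x)`; the index `0` is `none`. -/
noncomputable def ladderMatrix (γ : Fin r → ℝ → ℂ) (w v' : Fin r → ℂ → ℂ)
    (P : (Fin r → ℕ) → ℂ[X]) (A : (Fin r → ℕ) → Fin r → ℂ[X]) (n : Fin r → ℕ) (x : ℂ) :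
    Matrix (Option (Fin r)) (Option (Fin r)) ℂ :=
  Matrix.of fun i j =>
    match j with
    | none => ∑ k, curveIntegral (γ k) (fun t =>
        (lowered P n i).eval t * ((A n k).eval t * ((v' k t - v' k x) / (x - t)) * w k t))
    | some j => (recurrenceCoeff γ w P n j * ∑ k, curveIntegral (γ k) (fun t =>
        (lowered P n i).eval t *
          ((A (n + Pi.single j 1) k).eval t * ((v' k t - v' k x) / (t - x)) * w k t))) +
        (if i = some j then v' j x else 0)

end MultipleOrthogonal

open MultipleOrthogonal

/-! Normality provides a reproducing kernel at `x`: polynomials `K k` of degree below `n k` such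
that `∑ₖ ∫ p K_k dμ_k = p(x)` whenever `deg p < |n|`. Apply this to `p'`, where `p` is `P_n` or
`P_{n-e_i}`. Orthogonality kills `∫ p K_k' dμ_k`, so `p'` may be replaced by the derivative of the
whole product `p K_k`, and integration by parts turns `p'(x)` into `∑ₖ ∫ p K_k v_k' w_k dt`.

Split `v_k'(t) = (v_k'(t) - v_k'(x)) + v_k'(x)`. In the first part the Christoffel–Darboux formula
(`christoffel_darboux`) expresses `(x - t) K_k(t)` through `A_n` and the `A_{n+e_j}`, which yields
the ladder integrals. The second part is `∑ₖ v_k'(x) ∫ p K_k dμ_k`: zero for `P_n`, and `v_i'(x)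
P_{n-e_i}(x)` for `P_{n-e_i}`.

The Christoffel–Darboux formula is pure algebra of linear functionals. The analytic input is
`curveIntegral_derivative`, whose point is that the boundary terms vanish even on unbounded arcs. -/

namespace MultipleOrthogonal

/-! ### Linear functionals on polynomials, normality and the reproducing kernel -/

/-- Linear functionals that agree on `1, X, …, X ^ (N - 1)` agree in degree less than `N`. -/
theorem linearMap_eq_of_degree_lt {φ ψ : ℂ[X] →ₗ[ℂ] ℂ} {N : ℕ}
    (h : ∀ a < N, φ (X ^ a) = ψ (X ^ a)) {p : ℂ[X]} (hp : p.degree < N) : φ p = ψ p := by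
  -- The range has one spare term because the zero polynomial has `natDegree` 0, which is not below
  -- `N` when `N = 0`.
  rw [p.as_sum_range' (N + 1) (by
    exact Nat.lt_succ_of_le (natDegree_le_of_degree_le hp.le)), map_sum, map_sum]
  refine Finset.sum_congr rfl fun a ha => ?_
  rw [← C_mul_X_pow_eq_monomial, ← smul_eq_C_mul, map_smul, map_smul]
  rcases Nat.lt_succ_iff_lt_or_eq.1 (Finset.mem_range.1 ha) with ha | rfl
  · rw [h a ha]
  · rw [coeff_eq_zero_of_degree_lt hp, zero_smul, zero_smul]

/-- A functional that annihilates degree less than `N` only sees the coefficient of `X ^ N` in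
degree at most `N`. -/
theorem linearMap_apply_eq_coeff_mul {φ : ℂ[X] →ₗ[ℂ] ℂ} {N : ℕ}
    (h : ∀ a < N, φ (X ^ a) = 0) {p : ℂ[X]} (hp : p.degree < (N + 1 : ℕ)) :
    φ p = p.coeff N * φ (X ^ N) := by
  have := linearMap_eq_of_degree_lt (φ := φ) (ψ := (lcoeff ℂ N).smulRight (φ (X ^ N)))
    (N := N + 1) (fun a ha => ?_) hp
  · simpa using this
  · rcases Nat.lt_succ_iff_lt_or_eq.1 ha with ha | rfl
    · simp [h a ha, coeff_X_pow, ha.ne']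
    · simp

variable {r : ℕ}

/-- The functional `p ↦ ∑ₖ Lₖ (p Bₖ)`. -/
noncomputable def pairing (L : Fin r → ℂ[X] →ₗ[ℂ] ℂ) (B : Fin r → ℂ[X]) : ℂ[X] →ₗ[ℂ] ℂ :=
  ∑ k, L k ∘ₗ LinearMap.mulRight ℂ (B k)

theorem pairing_apply (L : Fin r → ℂ[X] →ₗ[ℂ] ℂ) (B : Fin r → ℂ[X]) (p : ℂ[X]) :
    pairing L B p = ∑ k, L k (p * B k) := by
  simp [pairing]

/-- The matrix of mixed moments of the functionals `L`. -/
noncomputable def functionalMatrix (L : Fin r → ℂ[X] →ₗ[ℂ] ℂ) (n : Fin r → ℕ) :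
    Matrix (Fin (∑ j, n j)) (Fin (∑ j, n j)) ℂ :=
  Matrix.of fun a b => L (finSigmaFinEquiv.symm b).1
    (X ^ ((a : ℕ) + ((finSigmaFinEquiv.symm b).2 : ℕ)))

/-- The dictionary between vectors and tuples of polynomials: injectivity of the matrix becomes
uniqueness of a tuple with given pairings, and surjectivity becomes existence of the kernel. -/
theorem functionalMatrix_mulVec (L : Fin r → ℂ[X] →ₗ[ℂ] ℂ) (n : Fin r → ℕ)
    (c : (Σ j, Fin (n j)) → ℂ) (a : Fin (∑ j, n j)) :
    (functionalMatrix L n).mulVec (fun b => c (finSigmaFinEquiv.symm b)) a =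
      pairing L (fun k => ∑ l : Fin (n k), C (c ⟨k, l⟩) * X ^ (l : ℕ)) (X ^ (a : ℕ)) := by
  rw [pairing_apply, Matrix.mulVec, dotProduct,
    ← Equiv.sum_comp finSigmaFinEquiv, Fintype.sum_sigma]
  refine Finset.sum_congr rfl fun k _ => ?_
  rw [Finset.mul_sum, map_sum]
  refine Finset.sum_congr rfl fun l _ => ?_
  rw [mul_left_comm, ← pow_add, ← smul_eq_C_mul, map_smul, functionalMatrix, Matrix.of_apply,
    Equiv.symm_apply_apply, smul_eq_mul, mul_comm]

theorem eq_zero_of_pairing_eq_zero {L : Fin r → ℂ[X] →ₗ[ℂ] ℂ} {n : Fin r → ℕ}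
    (hn : (functionalMatrix L n).det ≠ 0) {B : Fin r → ℂ[X]}
    (hB : ∀ k, (B k).degree < (n k : WithBot ℕ))
    (h : ∀ a < ∑ j, n j, pairing L B (X ^ a) = 0) (k : Fin r) : B k = 0 := by
  have hsum : (fun k => ∑ l : Fin (n k), C ((B k).coeff l) * X ^ (l : ℕ)) = B := by
    funext k
    rw [Fin.sum_univ_eq_sum_range (fun l => C ((B k).coeff l) * X ^ l)]
    ext m
    simp only [finsetSum_coeff, coeff_C_mul, coeff_X_pow, mul_ite, mul_one, mul_zero,
      Finset.sum_ite_eq, Finset.mem_range]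
    split_ifs with hm
    · rfl
    · exact (coeff_eq_zero_of_degree_lt ((hB k).trans_le (by exact_mod_cast not_lt.1 hm))).symm
  have h0 := Matrix.eq_zero_of_mulVec_eq_zero hn
    (v := fun b => (fun q : Σ j, Fin (n j) => (B q.1).coeff q.2) (finSigmaFinEquiv.symm b)) (by
      funext a
      refine (functionalMatrix_mulVec L n (fun q => (B q.1).coeff q.2) a).trans ?_
      rw [hsum, h a a.2, Pi.zero_apply])
  rw [← hsum]
  refine Finset.sum_eq_zero fun l _ => ?_
  have := congrFun h0 (finSigmaFinEquiv ⟨k, l⟩)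
  have hl : (B k).coeff l = 0 := by
    beta_reduce at this
    rwa [Equiv.symm_apply_apply] at this
  simp only [hl, map_zero, zero_mul]

/-- Existence of the reproducing kernel at the point `x`. -/
theorem exists_reproducing {L : Fin r → ℂ[X] →ₗ[ℂ] ℂ} {n : Fin r → ℕ}
    (hn : (functionalMatrix L n).det ≠ 0) (x : ℂ) :
    ∃ K : Fin r → ℂ[X], (∀ k, (K k).degree < (n k : WithBot ℕ)) ∧
      ∀ p : ℂ[X], p.degree < ((∑ j, n j : ℕ) : WithBot ℕ) → pairing L K p = p.eval x := by
  -- Reproducing `X ^ a` for all `a < |n|` is a square linear system for the coefficients of the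
  -- kernel, with the mixed moment matrix and right-hand side `x ^ a`.
  obtain ⟨c, hc⟩ := (Matrix.mulVec_surjective_iff_isUnit.2
    ((Matrix.isUnit_iff_isUnit_det _).2 hn.isUnit)) (fun a : Fin (∑ j, n j) => x ^ (a : ℕ))
  refine ⟨fun k => ∑ l : Fin (n k), C (c (finSigmaFinEquiv ⟨k, l⟩)) * X ^ (l : ℕ),
    fun k => ?_, fun p hp => ?_⟩
  · refine (degree_sum_le _ _).trans_lt ((Finset.sup_lt_iff (WithBot.bot_lt_coe _)).2 fun l _ => ?_)
    exact (degree_C_mul_X_pow_le _ _).trans_lt (by exact_mod_cast l.2)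
  · refine (linearMap_eq_of_degree_lt (ψ := (leval x)) (fun a ha => ?_) hp).trans rfl
    rw [← functionalMatrix_mulVec L n (fun q => c (finSigmaFinEquiv q)) ⟨a, ha⟩]
    simpa [leval] using congrFun hc ⟨a, ha⟩

theorem sum_add_single (n : Fin r → ℕ) (j : Fin r) :
    ∑ k, (n + Pi.single j 1 : Fin r → ℕ) k = (∑ k, n k) + 1 := by
  simp [Finset.sum_add_distrib]

theorem sub_single_add_single {n : Fin r → ℕ} {j : Fin r} (h : n j ≠ 0) :
    n - Pi.single j 1 + Pi.single j 1 = n := by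
  funext k
  rcases eq_or_ne k j with rfl | hk
  · simp; omega
  · simp [hk]

/-! ### Biorthogonality and the Christoffel–Darboux formula -/

/-- `P` and `A` are multiple orthogonal of type II and type I with respect to the functionals `L`. -/
structure IsBiorthogonal (L : Fin r → ℂ[X] →ₗ[ℂ] ℂ) (P : (Fin r → ℕ) → ℂ[X])
    (A : (Fin r → ℕ) → Fin r → ℂ[X]) : Prop where
  normal : ∀ n, (functionalMatrix L n).det ≠ 0
  monic : ∀ n, (P n).Monic
  natDegree : ∀ n, (P n).natDegree = ∑ j, n j
  orthogonal : ∀ n j, ∀ l < n j, L j (P n * X ^ l) = 0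
  degree : ∀ n j, (A n j).degree < (n j : WithBot ℕ)
  pairing_eq_zero : ∀ n l, l + 1 < ∑ j, n j → pairing L (A n) (X ^ l) = 0
  pairing_eq_one : ∀ n l, l + 1 = ∑ j, n j → pairing L (A n) (X ^ l) = 1

namespace IsBiorthogonal

variable {L : Fin r → ℂ[X] →ₗ[ℂ] ℂ} {P : (Fin r → ℕ) → ℂ[X]} {A : (Fin r → ℕ) → Fin r → ℂ[X]}

theorem degree_eq (h : IsBiorthogonal L P A) (n : Fin r → ℕ) :
    (P n).degree = ((∑ j, n j : ℕ) : WithBot ℕ) := by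
  rw [degree_eq_natDegree (h.monic n).ne_zero, h.natDegree]

theorem map_mul_eq_zero (h : IsBiorthogonal L P A) (n : Fin r → ℕ) (j : Fin r) {q : ℂ[X]}
    (hq : q.degree < (n j : WithBot ℕ)) : L j (P n * q) = 0 :=
  linearMap_eq_of_degree_lt (φ := L j ∘ₗ LinearMap.mulLeft ℂ (P n)) (ψ := 0)
    (fun a ha => by simpa using h.orthogonal n j a ha) hq

theorem map_mul_eq_coeff_mul (h : IsBiorthogonal L P A) (n : Fin r → ℕ) (j : Fin r) {q : ℂ[X]}
    (hq : q.degree < (n j + 1 : ℕ)) : L j (P n * q) = q.coeff (n j) * L j (P n * X ^ n j) :=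
  linearMap_apply_eq_coeff_mul (φ := L j ∘ₗ LinearMap.mulLeft ℂ (P n))
    (fun a ha => by simpa using h.orthogonal n j a ha) hq

theorem degree_add_single_lt (h : IsBiorthogonal L P A) (n : Fin r → ℕ) (j k : Fin r) :
    (A (n + Pi.single j 1) k).degree < (n k + 1 : ℕ) := by
  refine (h.degree _ k).trans_le ?_
  have : (n + Pi.single j 1 : Fin r → ℕ) k ≤ n k + 1 := by
    rcases eq_or_ne k j with rfl | hk
    · simp
    · simp [hk]
  exact_mod_cast this

theorem degree_add_single_lt_of_ne (h : IsBiorthogonal L P A) (n : Fin r → ℕ) {j k : Fin r}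
    (hk : k ≠ j) : (A (n + Pi.single j 1) k).degree < (n k : WithBot ℕ) := by
  have hnk : (n + Pi.single j 1 : Fin r → ℕ) k = n k := by simp [hk]
  exact (h.degree _ k).trans_eq (congrArg _ hnk)

/-- The leading coefficient of the type I polynomial is the inverse of the norm of the type II
polynomial. -/
theorem coeff_mul_norm (h : IsBiorthogonal L P A) (n : Fin r → ℕ) (j : Fin r) :
    (A (n + Pi.single j 1) j).coeff (n j) * L j (P n * X ^ n j) = 1 := by
  -- The pairing of `A_{n+e_j}` with `P_n` is computed twice: the type I conditions see only the
  -- leading term of `P_n`, the type II conditions only the top coefficient of the `j`-th component.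
  have h1 : pairing L (A (n + Pi.single j 1)) (P n) = 1 := by
    rw [linearMap_apply_eq_coeff_mul (N := ∑ k, n k)
      (fun a ha => h.pairing_eq_zero _ a (by rw [sum_add_single]; omega))
      (by rw [h.degree_eq]; exact_mod_cast Nat.lt_succ_self _),
      h.pairing_eq_one _ _ (sum_add_single n j).symm, mul_one, ← h.natDegree n]
    exact h.monic n
  rw [pairing_apply, Finset.sum_eq_single j
    (fun k _ hk => h.map_mul_eq_zero n k (h.degree_add_single_lt_of_ne n hk))
    (fun hj => absurd (Finset.mem_univ j) hj),
    h.map_mul_eq_coeff_mul n j (h.degree_add_single_lt n j j)] at h1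
  exact h1

variable {n : Fin r → ℕ} {x : ℂ} {K : Fin r → ℂ[X]}

theorem degree_darboux_lt (h : IsBiorthogonal L P A) (hK : ∀ k, (K k).degree < (n k : WithBot ℕ))
    (c : ℂ) (d : Fin r → ℂ) (k : Fin r) :
    ((C x - X) * K k - (C c * A n k - ∑ j, C (d j) * A (n + Pi.single j 1) k)).degree
      < ((n k + 1 : ℕ) : WithBot ℕ) := by
  have lt_succ : ∀ {q : ℂ[X]}, q.degree < (n k : WithBot ℕ) → q ∈ degreeLT ℂ (n k + 1) :=
    fun hq => mem_degreeLT.2 (hq.trans (by exact_mod_cast Nat.lt_succ_self _))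
  rw [← mem_degreeLT, sub_mul]
  simp only [← smul_eq_C_mul]
  refine sub_mem (sub_mem (Submodule.smul_mem _ _ (lt_succ (hK k))) (mem_degreeLT.2 ?_))
    (sub_mem (Submodule.smul_mem _ _ (lt_succ (h.degree n k))) (sum_mem fun j _ =>
      Submodule.smul_mem _ _ (mem_degreeLT.2 (h.degree_add_single_lt n j k))))
  rcases eq_or_ne (K k) 0 with h0 | h0
  · rw [h0, mul_zero, degree_zero]
    exact WithBot.bot_lt_coe _
  · rw [degree_eq_natDegree (mul_ne_zero X_ne_zero h0), natDegree_X_mul h0]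
    exact_mod_cast Nat.succ_lt_succ ((natDegree_lt_iff_degree_lt h0).2 (hK k))

/-- The leading coefficients of the reproducing kernel. -/
theorem leadingCoeff_kernel (h : IsBiorthogonal L P A)
    (hK : ∀ k, (K k).degree < (n k : WithBot ℕ))
    (hKx : ∀ p : ℂ[X], p.degree < ((∑ j, n j : ℕ) : WithBot ℕ) → pairing L K p = p.eval x)
    {k : Fin r} {m : ℕ} (hm : n k = m + 1) :
    (K k).coeff m * L k (P (n - Pi.single k 1) * X ^ m) = (P (n - Pi.single k 1)).eval x := by
  have hnk : n k ≠ 0 := by omega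
  have hmk : (n - Pi.single k 1 : Fin r → ℕ) k = m := by simp [hm]
  have hmj : ∀ j, j ≠ k → (n - Pi.single k 1 : Fin r → ℕ) j = n j := fun j hj => by simp [hj]
  -- `P_{n-e_k}` has degree `|n| - 1`, so it is reproduced; its orthogonality leaves only the top
  -- coefficient of `K k` in the pairing.
  have hrep := hKx (P (n - Pi.single k 1)) (by
    rw [h.degree_eq]
    have := sum_add_single (n - Pi.single k 1) k
    rw [sub_single_add_single hnk] at this
    rw [this]
    exact_mod_cast Nat.lt_succ_self _)
  rw [pairing_apply, Finset.sum_eq_single k (fun j _ hj => h.map_mul_eq_zero _ j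
      ((hK j).trans_eq (congrArg _ (hmj j hj).symm))) (fun hk => absurd (Finset.mem_univ k) hk),
    h.map_mul_eq_coeff_mul _ k ((hK k).trans_eq (by rw [hm, hmk])), hmk] at hrep
  exact hrep

/-- In degree `n k` only `-X * K k` and the term `j = k` contribute. They cancel because the top
coefficient of `K k` is `P_{n-e_k}(x)` over the norm of `P_{n-e_k}`, that of `A_{n+e_k,k}` is the
inverse norm of `P_n`, and `a k` is the quotient of the two norms. The scalar `c` plays no role
since `A n k` has lower degree. -/
theorem coeff_darboux (h : IsBiorthogonal L P A) (hK : ∀ k, (K k).degree < (n k : WithBot ℕ))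
    (hKx : ∀ p : ℂ[X], p.degree < ((∑ j, n j : ℕ) : WithBot ℕ) → pairing L K p = p.eval x)
    {a : Fin r → ℂ} (ha : ∀ j, n j ≠ 0 → a j = L j (P n * X ^ n j) /
      L j (P (n - Pi.single j 1) * X ^ (n j - 1))) (c : ℂ) (k : Fin r) :
    ((C x - X) * K k - (C c * A n k - ∑ j, C (a j * (lowered P n (some j)).eval x) *
      A (n + Pi.single j 1) k)).coeff (n k) = 0 := by
  have hcoeff : (K k).coeff (n k) = 0 := coeff_eq_zero_of_degree_lt (hK k)
  have hA : (A n k).coeff (n k) = 0 := coeff_eq_zero_of_degree_lt (h.degree n k)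
  simp only [coeff_sub, sub_mul, coeff_C_mul, hcoeff, hA, finsetSum_coeff, mul_zero, zero_sub]
  rw [Finset.sum_eq_single k (fun j _ hj => by
    rw [coeff_eq_zero_of_degree_lt (h.degree_add_single_lt_of_ne n hj.symm), mul_zero])
    (fun hk => absurd (Finset.mem_univ k) hk)]
  rcases Nat.eq_zero_or_eq_succ_pred (n k) with hnk | hm
  · simp [lowered, hnk]
  have hnk : n k ≠ 0 := by omega
  generalize (n k).pred = m at hm
  rw [Nat.succ_eq_add_one] at hm
  have hmk : (n - Pi.single k 1 : Fin r → ℕ) k = m := by simp [hm]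
  have hH := h.coeff_mul_norm (n - Pi.single k 1) k
  rw [hmk] at hH
  have hH0 := right_ne_zero_of_mul_eq_one hH
  have hn := h.coeff_mul_norm n k
  rw [ha k hnk, lowered, if_neg hnk, ← h.leadingCoeff_kernel hK hKx hm]
  rw [hm] at hn ⊢
  rw [Nat.add_sub_cancel, coeff_X_mul]
  field_simp
  linear_combination (K k).coeff m * hn

/-- For `l < |n| - 1` the polynomial `(x - X) X ^ l` is reproduced and vanishes at `x`. For `l = |n|
- 1` its degree is `|n|`, too large by one; adding `P n`, which the kernel annihilates, cancels the
leading term, and evaluation at `x` leaves `P_n(x)`. -/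
theorem pairing_kernel_mul (h : IsBiorthogonal L P A)
    (hK : ∀ k, (K k).degree < (n k : WithBot ℕ))
    (hKx : ∀ p : ℂ[X], p.degree < ((∑ j, n j : ℕ) : WithBot ℕ) → pairing L K p = p.eval x)
    {l : ℕ} (hl : l < ∑ j, n j) :
    pairing L K ((C x - X) * X ^ l) = (P n).eval x * pairing L (A n) (X ^ l) := by
  have hlow : (C x * X ^ l).degree < ((∑ j, n j : ℕ) : WithBot ℕ) :=
    (degree_C_mul_X_pow_le _ _).trans_lt (by exact_mod_cast hl)
  rcases (Nat.succ_le_of_lt hl).lt_or_eq with hl' | hl'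
  · rw [h.pairing_eq_zero n l hl', hKx]
    · simp
    · rw [sub_mul, ← pow_succ']
      refine (degree_sub_le _ _).trans_lt (max_lt hlow ?_)
      rw [degree_X_pow]
      exact_mod_cast hl'
  · have hP0 : pairing L K (P n) = 0 := by
      rw [pairing_apply]
      exact Finset.sum_eq_zero fun k _ => h.map_mul_eq_zero n k (hK k)
    have := hKx ((C x - X) * X ^ l + P n) (by
      have : (C x - X) * X ^ l + P n = C x * X ^ l + (P n - X ^ (∑ j, n j)) := by
        rw [← hl', Nat.succ_eq_add_one]; ring
      rw [this]
      refine (degree_add_le _ _).trans_lt (max_lt hlow ?_)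
      rw [← h.degree_eq n]
      refine degree_sub_lt_left ?_ (h.monic n).ne_zero ?_
      · rw [h.degree_eq, degree_X_pow]
      · rw [h.monic n, leadingCoeff_X_pow])
    rw [map_add, hP0, add_zero] at this
    rw [this, h.pairing_eq_one n l hl']
    simp

/-- The Christoffel–Darboux formula. -/
theorem christoffel_darboux (h : IsBiorthogonal L P A)
    (hK : ∀ k, (K k).degree < (n k : WithBot ℕ))
    (hKx : ∀ p : ℂ[X], p.degree < ((∑ j, n j : ℕ) : WithBot ℕ) → pairing L K p = p.eval x)
    {a : Fin r → ℂ} (ha : ∀ j, n j ≠ 0 → a j = L j (P n * X ^ n j) /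
      L j (P (n - Pi.single j 1) * X ^ (n j - 1))) (k : Fin r) :
    (C x - X) * K k = C ((P n).eval x) * A n k -
      ∑ j, C (a j * (lowered P n (some j)).eval x) * A (n + Pi.single j 1) k := by
  obtain ⟨D, hD⟩ : ∃ D : Fin r → ℂ[X], ∀ k, D k = (C x - X) * K k -
      (C ((P n).eval x) * A n k -
        ∑ j, C (a j * (lowered P n (some j)).eval x) * A (n + Pi.single j 1) k) := ⟨_, fun _ => rfl⟩
  suffices h0 : D k = 0 from sub_eq_zero.1 ((hD k).symm.trans h0)
  -- By normality it suffices that the difference `D` of the two sides has degrees below `n k` and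
  -- pairs to zero with all `X ^ l`, `l < |n|`.
  refine eq_zero_of_pairing_eq_zero (h.normal n) (fun k => ?_) (fun l hl => ?_) k
  · have hdeg := h.degree_darboux_lt (x := x) hK ((P n).eval x)
      (fun j => a j * (lowered P n (some j)).eval x) k
    have hc := h.coeff_darboux hK hKx ha ((P n).eval x) k
    rw [← hD, degree_lt_iff_coeff_zero] at hdeg
    rw [← hD] at hc
    rw [degree_lt_iff_coeff_zero]
    intro m hm
    rcases hm.lt_or_eq with hm | rfl
    · exact hdeg m hm
    · exact hc
  -- Since `|n + e_j| = |n| + 1`, each `A_{n+e_j}` annihilates every degree below `|n|`; only the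
  -- kernel and `A_n` remain.
  · have hzero : ∀ j, pairing L (A (n + Pi.single j 1)) (X ^ l) = 0 := fun j =>
      h.pairing_eq_zero _ l (by rw [sum_add_single]; omega)
    have hCmul : ∀ (k : Fin r) (c : ℂ) (q : ℂ[X]), L k (X ^ l * (C c * q)) = c * L k (X ^ l * q) :=
      fun k c q => by rw [mul_left_comm, ← smul_eq_C_mul, map_smul, smul_eq_mul]
    have key := h.pairing_kernel_mul hK hKx hl
    have hcomm : ∀ k, L k (X ^ l * ((C x - X) * K k)) = L k ((C x - X) * X ^ l * K k) :=
      fun k => by rw [mul_left_comm, mul_assoc]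
    rw [pairing_apply]
    simp only [pairing_apply] at hzero key
    simp only [hD]
    simp only [mul_sub (X ^ l), map_sub, Finset.mul_sum, map_sum, hCmul, Finset.sum_sub_distrib]
    rw [Finset.sum_comm]
    simp only [← Finset.mul_sum, hzero, mul_zero, Finset.sum_const_zero, sub_zero, hcomm]
    rw [← key, sub_self]

end IsBiorthogonal
end MultipleOrthogonal

/-! ### Integration by parts along an arc -/

namespace MultipleOrthogonal
open MeasureTheory Filter Topology Set

theorem integral_eq_sub_of_hasDerivAt_off_countable {f f' : ℝ → ℂ} {C : Set ℝ} (hC : C.Countable)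
    (hf : Continuous f) (hf' : ∀ s ∉ C, HasDerivAt f (f' s) s) (a b : ℝ)
    (hi : IntervalIntegrable f' volume a b) : ∫ s in a..b, f' s = f b - f a :=
  MeasureTheory.integral_eq_of_hasDerivAt_off_countable f f' hC hf.continuousOn
    (fun s hs => hf' s hs.2) hi

theorem exists_tendsto_atTop {f f' : ℝ → ℂ} {C : Set ℝ} (hC : C.Countable)
    (hf : Continuous f) (hf' : ∀ s ∉ C, HasDerivAt f (f' s) s) {a : ℝ}
    (hi : IntegrableOn f' (Ioi a)) : ∃ l, Tendsto f atTop (𝓝 l) := by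
  refine ⟨f a + ∫ s in Ioi a, f' s, ?_⟩
  refine ((intervalIntegral_tendsto_integral_Ioi a hi tendsto_id).const_add (f a)).congr' ?_
  filter_upwards [eventually_ge_atTop a] with b hb
  rw [id, integral_eq_sub_of_hasDerivAt_off_countable hC hf hf' a b
    ((intervalIntegrable_iff_integrableOn_Ioc_of_le hb).2 (hi.mono_set Ioc_subset_Ioi_self))]
  ring

/-- If a polynomial times a weight has an integrable derivative along an arc, then it tends to
zero where the weight does: an arc of finite length is bounded. -/
theorem tendsto_eval_mul_zero {γ γ' g f' : ℝ → ℂ} {q : ℂ[X]} {C : Set ℝ} (hC : C.Countable)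
    (hγ : Continuous γ) (hγ' : ∀ s ∉ C, HasDerivAt γ (γ' s) s) (hg : Continuous g)
    (hg0 : Tendsto g atTop (𝓝 0))
    (hf : ∀ s ∉ C, HasDerivAt (fun s => q.eval (γ s) * g s) (f' s) s) (hf' : Integrable f')
    (hint : Integrable (fun s => q.eval (γ s) * g s * γ' s))
    (hmeas : AEStronglyMeasurable γ') :
    Tendsto (fun s => q.eval (γ s) * g s) atTop (𝓝 0) := by
  have hcont : Continuous (fun s => q.eval (γ s) * g s) := (q.continuous.comp hγ).mul hg
  obtain ⟨l, hl⟩ := exists_tendsto_atTop hC hcont hf (a := 0) hf'.integrableOn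
  rcases eq_or_ne l 0 with rfl | hl0
  · exact hl
  -- If the limit `l` were nonzero, `|q w| ≥ |l| / 2` near the end, so integrability of `q w γ'`
  -- makes `γ'` integrable there. Then `γ` converges, `q ∘ γ` converges, and the product tends to
  -- zero with `g`.
  have hpos : 0 < ‖l‖ / 2 := by positivity
  obtain ⟨a, ha⟩ := eventually_atTop.1
    (hl.norm.eventually (lt_mem_nhds (half_lt_self (norm_pos_iff.2 hl0))))
  have hγi : IntegrableOn γ' (Ioi a) := by
    refine ((hint.norm.const_mul (‖l‖ / 2)⁻¹).integrableOn).mono' hmeas.restrict ?_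
    refine (ae_restrict_mem measurableSet_Ioi).mono fun s hs => ?_
    rw [norm_mul, ← div_eq_inv_mul, le_div_iff₀ hpos, mul_comm]
    exact mul_le_mul_of_nonneg_right (ha s (le_of_lt hs)).le (norm_nonneg _)
  obtain ⟨z, hz⟩ := exists_tendsto_atTop hC hγ hγ' hγi
  simpa using ((q.continuous.tendsto z).comp hz).mul hg0

variable {γ : ℝ → ℂ} {w v v' : ℂ → ℂ}

theorem IsSimpleCurve.exists_countable (h : IsSimpleCurve γ) :
    ∃ F : Set ℝ, F.Countable ∧ ∀ s ∉ F, HasDerivAt γ (deriv γ s) s := by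
  obtain ⟨F, hF, hs⟩ := h.piecewise_smooth
  refine ⟨F, ?_, fun s h => ((hs s h).1.differentiableAt (by norm_num)).hasDerivAt⟩
  have : F = ⋃ m : ℕ, F ∩ Icc (-(m : ℝ)) m := by
    ext s
    obtain ⟨m, hm⟩ := exists_nat_ge |s|
    simp only [mem_iUnion, mem_inter_iff, mem_Icc]
    exact ⟨fun h => ⟨m, h, abs_le.1 hm⟩, fun ⟨_, h, _⟩ => h⟩
  rw [this]
  exact countable_iUnion fun m => (hF _ _).countable

theorem curveIntegrable_eval_mul (hm : ∀ m : ℕ, CurveIntegrable γ (fun t => t ^ m * w t))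
    (q : ℂ[X]) : CurveIntegrable γ (fun t => q.eval t * w t) := by
  have : (fun s : ℝ => q.eval (γ s) * w (γ s) * deriv γ s) = fun s => ∑ m ∈ Finset.range
      (q.natDegree + 1), q.coeff m * (γ s ^ m * w (γ s) * deriv γ s) := by
    funext s
    rw [eval_eq_sum_range, Finset.sum_mul, Finset.sum_mul]
    exact Finset.sum_congr rfl fun m _ => by ring
  rw [CurveIntegrable, this]
  exact integrable_finsetSum _ fun m _ => (hm m).const_mul _

namespace IsVanishingWeight

/-- The derivative of the weight along the curve. -/
theorem exists_hasDerivAt (h : IsVanishingWeight γ w v v') :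
    ∃ F : Set ℝ, F.Countable ∧ ∀ s ∉ F, HasDerivAt γ (deriv γ s) s ∧
      HasDerivAt (fun s => w (γ s)) (-(v' (γ s) * w (γ s) * deriv γ s)) s := by
  obtain ⟨F, hF, hs⟩ := h.curve.exists_countable
  refine ⟨F ∪ frontier {s : ℝ | w (γ s) ≠ 0}, hF.union h.endpoints, fun s hsF => ?_⟩
  have hγ := hs s fun h => hsF (Or.inl h)
  refine ⟨hγ, ?_⟩
  have hopen : IsOpen {s : ℝ | w (γ s) ≠ 0} := isOpen_ne_fun h.continuous continuous_const
  by_cases hw : w (γ s) = 0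
  -- A zero of the weight off the frontier lies outside the closure of the open set where it is
  -- nonzero, so the weight vanishes nearby. The arbitrary value of `v'` there is multiplied by
  -- zero.
  · have hcl : s ∉ closure {s : ℝ | w (γ s) ≠ 0} := fun hc =>
      hsF (Or.inr ⟨hc, by rw [hopen.interior_eq]; exact fun h => h hw⟩)
    have hev : (fun s => w (γ s)) =ᶠ[𝓝 s] fun _ => 0 := by
      filter_upwards [isClosed_closure.isOpen_compl.mem_nhds hcl] with u hu
      by_contra hu0
      exact hu (subset_closure hu0)
    simpa [hw] using (hasDerivAt_const s (0 : ℂ)).congr_of_eventuallyEq hev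
  · have hnear : ∀ᶠ u in 𝓝 s, w (γ u) ≠ 0 := hopen.mem_nhds hw
    have hmaps : MapsTo γ {s : ℝ | w (γ s) ≠ 0} (nonvanishingSet γ w) :=
      fun u hu => ⟨mem_range_self u, hu⟩
    -- The derivative of `v` is only relative to the nonvanishing set, but the corresponding
    -- parameters form an open set, so the composition has a genuine derivative.
    have hv : HasDerivAt (fun u => v (γ u)) (v' (γ s) * deriv γ s) s := by
      have := ((h.hasDeriv _ (hmaps hw)).comp s hγ.hasDerivWithinAt hmaps).hasDerivAt
        (hopen.mem_nhds hw)
      exact this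
    have := hv.neg.cexp
    refine (this.congr_of_eventuallyEq ?_).congr_deriv ?_
    · filter_upwards [hnear] with u hu
      exact (h.neg_log _ (hmaps hu)).symm
    · simp only [Pi.neg_apply]
      rw [h.neg_log _ (hmaps hw)]
      ring

/-- Integration by parts along the curve. -/
theorem curveIntegral_derivative (h : IsVanishingWeight γ w v v') (q : ℂ[X])
    (hq : CurveIntegrable γ (fun t => q.eval t * (v' t * w t))) :
    curveIntegral γ (fun t => q.derivative.eval t * w t) =
      curveIntegral γ (fun t => q.eval t * (v' t * w t)) := by
  obtain ⟨F, hF, hs⟩ := h.exists_hasDerivAt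
  set f : ℝ → ℂ := fun s => q.eval (γ s) * w (γ s) with hfdef
  set f' : ℝ → ℂ := fun s => q.derivative.eval (γ s) * w (γ s) * deriv γ s -
    q.eval (γ s) * (v' (γ s) * w (γ s)) * deriv γ s with hf'def
  have hi1 := curveIntegrable_eval_mul h.moments q.derivative
  have hi0 := curveIntegrable_eval_mul h.moments q
  have hf' : Integrable f' := hi1.sub hq
  have hcont : Continuous f := (q.continuous.comp h.curve.continuous).mul h.continuous
  have hder : ∀ s ∉ F, HasDerivAt f (f' s) s := fun s hsF => by
    refine (((q.hasDerivAt (γ s)).comp s (hs s hsF).1).mul (hs s hsF).2).congr_deriv ?_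
    simp only [hf'def, Function.comp]
    ring
  have htop : Tendsto f atTop (𝓝 0) :=
    tendsto_eval_mul_zero hF h.curve.continuous (fun s hsF => (hs s hsF).1) h.continuous
      h.vanish_right hder hf' hi0 (measurable_deriv γ).aestronglyMeasurable
  -- The left end is treated by reversing the arc.
  have hbot : Tendsto (fun s => f (-s)) atTop (𝓝 0) := by
    have hneg : ∀ {φ : ℝ → ℂ} {d : ℂ} {s : ℝ}, HasDerivAt φ d (-s) →
        HasDerivAt (fun s => φ (-s)) (-d) s := fun hφ => by
      have := hφ.scomp_of_eq _ (hasDerivAt_neg _) rfl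
      rw [neg_one_smul] at this
      exact this
    refine tendsto_eval_mul_zero (γ := fun s => γ (-s)) (γ' := fun s => -deriv γ (-s))
      (g := fun s => w (γ (-s))) (f' := fun s => -f' (-s)) (q := q) (C := Neg.neg ⁻¹' F)
      (hF.preimage neg_injective) (h.curve.continuous.comp continuous_neg)
      (fun s hsF => hneg (hs _ hsF).1) (h.continuous.comp continuous_neg)
      (h.vanish_left.comp tendsto_neg_atTop_atBot) (fun s hsF => hneg (hder _ hsF))
      hf'.comp_neg.neg ?_ ?_
    · simpa using hi0.comp_neg.neg
    · exact ((measurable_deriv γ).comp measurable_neg).neg.aestronglyMeasurable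
  have hlim := intervalIntegral_tendsto_integral hf' tendsto_neg_atTop_atBot tendsto_id
  have hzero : ∫ s, f' s = 0 := by
    refine tendsto_nhds_unique hlim ?_
    have := htop.sub hbot
    rw [sub_zero] at this
    refine this.congr fun b => ?_
    exact (integral_eq_sub_of_hasDerivAt_off_countable hF hcont hder _ _
      hf'.intervalIntegrable).symm
  rw [hf'def, integral_sub hi1 hq, sub_eq_zero] at hzero
  exact hzero

end IsVanishingWeight
end MultipleOrthogonal

/-! ### From the kernel to the ladder integrals -/

namespace MultipleOrthogonal
open MeasureTheory

section
variable {γ : ℝ → ℂ} {w : ℂ → ℂ}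

/-- The linear functional `q ↦ ∫ q(t) w(t) dt` on polynomials. -/
noncomputable def momentFunctional (hm : ∀ m : ℕ, CurveIntegrable γ (fun t => t ^ m * w t)) :
    ℂ[X] →ₗ[ℂ] ℂ where
  toFun q := curveIntegral γ (fun t => q.eval t * w t)
  map_add' p q := by
    refine Eq.trans ?_ (integral_add (curveIntegrable_eval_mul hm p)
      (curveIntegrable_eval_mul hm q))
    simp only [curveIntegral, eval_add, add_mul]
  map_smul' c q := by
    refine Eq.trans ?_ (integral_const_mul c _)
    simp only [curveIntegral, eval_smul, smul_eq_mul, mul_assoc]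

theorem momentFunctional_eq (hm : ∀ m : ℕ, CurveIntegrable γ (fun t => t ^ m * w t)) {q : ℂ[X]}
    {f : ℂ → ℂ} (hf : ∀ t, f t = q.eval t * w t) :
    momentFunctional hm q = curveIntegral γ f := by
  rw [funext hf]
  rfl

end

variable {r : ℕ} {γ : Fin r → ℝ → ℂ} {w v v' : Fin r → ℂ → ℂ}

theorem isBiorthogonal_momentFunctional
    (hm : ∀ k, ∀ m : ℕ, CurveIntegrable (γ k) (fun t => t ^ m * w k t))
    (hnormal : ∀ m : Fin r → ℕ, IsNormalIndex γ w m)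
    {P : (Fin r → ℕ) → ℂ[X]} (hP : ∀ m, IsTypeII γ w m (P m))
    {A : (Fin r → ℕ) → Fin r → ℂ[X]} (hA : ∀ m, IsTypeI γ w m (A m)) :
    IsBiorthogonal (fun k => momentFunctional (hm k)) P A where
  normal n := by
    have : functionalMatrix (fun k => momentFunctional (hm k)) n = mixedMomentMatrix γ w n := by
      ext a b
      simp only [functionalMatrix, mixedMomentMatrix, Matrix.of_apply, moment]
      exact momentFunctional_eq _ fun t => by rw [eval_pow, eval_X]
    rw [this]
    exact hnormal n
  monic n := (hP n).monic
  natDegree n := (hP n).natDegree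
  orthogonal n j l hl := (momentFunctional_eq _ fun t => by simp).trans ((hP n).orthogonal j l hl)
  degree n := (hA n).degree
  pairing_eq_zero n l hl := by
    rw [pairing_apply, ← (hA n).orthogonal l hl]
    exact Finset.sum_congr rfl fun k _ => momentFunctional_eq _ fun t => by simp
  pairing_eq_one n l hl := by
    rw [pairing_apply, ← (hA n).normalized l hl]
    exact Finset.sum_congr rfl fun k _ => momentFunctional_eq _ fun t => by simp

/-- Integration by parts against one component of the Christoffel–Darboux kernel. -/
theorem IsVanishingWeight.kernel_integral {γ : ℝ → ℂ} {w v v' : ℂ → ℂ}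
    (hw : IsVanishingWeight γ w v v') {x c : ℂ} {p K A₀ : ℂ[X]} {d : Fin r → ℂ}
    {A : Fin r → ℂ[X]} (hK : (C x - X) * K = C c * A₀ - ∑ j, C (d j) * A j)
    (h0 : CurveIntegrable γ
      (fun t => p.eval t * (A₀.eval t * ((v' t - v' x) / (x - t)) * w t)))
    (hj : ∀ j, CurveIntegrable γ
      (fun t => p.eval t * ((A j).eval t * ((v' t - v' x) / (x - t)) * w t))) :
    momentFunctional hw.moments (p * K).derivative =
      c * curveIntegral γ (fun t => p.eval t * (A₀.eval t * ((v' t - v' x) / (x - t)) * w t)) -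
      ∑ j, d j * curveIntegral γ
        (fun t => p.eval t * ((A j).eval t * ((v' t - v' x) / (x - t)) * w t)) +
      v' x * momentFunctional hw.moments (p * K) := by
  have hpK := curveIntegrable_eval_mul hw.moments (p * K)
  have hsum := integrable_finsetSum Finset.univ fun j _ => (hj j).const_mul (d j)
  have hmain := (h0.const_mul c).sub hsum
  have hae : (fun s => (p * K).eval (γ s) * (v' (γ s) * w (γ s)) * deriv γ s) =ᵐ[volume]
      fun s => (c * (p.eval (γ s) * (A₀.eval (γ s) * ((v' (γ s) - v' x) / (x - γ s)) * w (γ s)) *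
        deriv γ s) - ∑ j, d j * (p.eval (γ s) * ((A j).eval (γ s) *
        ((v' (γ s) - v' x) / (x - γ s)) * w (γ s)) * deriv γ s)) +
        v' x * ((p * K).eval (γ s) * w (γ s) * deriv γ s) := by
    -- A simple arc passes through `x` at most once, so almost everywhere one may divide by `x - t`.
    have hfin : (γ ⁻¹' {x}).Finite := (Set.finite_singleton x).preimage hw.curve.injective.injOn
    filter_upwards [hfin.countable.ae_notMem volume] with s hs
    have hne : x - γ s ≠ 0 := sub_ne_zero.2 fun h => hs h.symm
    have hKs := congrArg (eval (γ s)) hK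
    simp only [eval_mul, eval_sub, eval_C, eval_X, eval_finsetSum] at hKs ⊢
    have : ∑ j, d j * (p.eval (γ s) * ((A j).eval (γ s) *
        ((v' (γ s) - v' x) / (x - γ s)) * w (γ s)) * deriv γ s) =
        (∑ j, d j * (A j).eval (γ s)) * (p.eval (γ s) *
        ((v' (γ s) - v' x) / (x - γ s)) * w (γ s) * deriv γ s) := by
      rw [Finset.sum_mul]
      exact Finset.sum_congr rfl fun j _ => by ring
    rw [this]
    field_simp
    linear_combination (p.eval (γ s) * (v' (γ s) - v' x) * w (γ s) * deriv γ s) * hKs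
  -- The integrability of `p K v' w` needed for integration by parts follows from that of the ladder
  -- integrands and from the finite moments.
  have hint := hmain.add (hpK.const_mul (v' x))
  refine (hw.curveIntegral_derivative (p * K) (hint.congr hae.symm)).trans ?_
  refine (integral_congr_ae hae).trans ((integral_add hmain (hpK.const_mul (v' x))).trans ?_)
  refine congrArg₂ (· + ·) ?_ (integral_const_mul _ _)
  refine (integral_sub (h0.const_mul c) hsum).trans ?_
  rw [integral_const_mul, integral_finsetSum _
    fun j _ => (hj j).const_mul (d j)]
  simp only [integral_const_mul]
  rfl

/-- The derivative of a polynomial that is orthogonal to the derivative of the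
Christoffel–Darboux kernel. -/
theorem derivative_eval_eq (hw : ∀ k, IsVanishingWeight (γ k) (w k) (v k) (v' k)) {x c : ℂ}
    {n : Fin r → ℕ} {p : ℂ[X]} {K A₀ : Fin r → ℂ[X]} {d : Fin r → ℂ} {A : Fin r → Fin r → ℂ[X]}
    (hKx : ∀ p : ℂ[X], p.degree < ((∑ j, n j : ℕ) : WithBot ℕ) →
      pairing (fun k => momentFunctional (hw k).moments) K p = p.eval x)
    (hK : ∀ k, (C x - X) * K k = C c * A₀ k - ∑ j, C (d j) * A j k)
    (hp : p.derivative.degree < ((∑ j, n j : ℕ) : WithBot ℕ))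
    (hpK : ∀ k, momentFunctional (hw k).moments (p * (K k).derivative) = 0)
    (h0 : LadderIntegrable γ w v' p A₀ x) (hj : ∀ j, LadderIntegrable γ w v' p (A j) x) :
    p.derivative.eval x = c * ladderIntegral γ w v' p A₀ x -
      ∑ j, d j * ladderIntegral γ w v' p (A j) x +
      ∑ k, v' k x * momentFunctional (hw k).moments (p * K k) := by
  rw [← hKx _ hp, pairing_apply]
  have : ∀ k, momentFunctional (hw k).moments (derivative p * K k) =
      momentFunctional (hw k).moments (p * K k).derivative := fun k => by
    rw [derivative_mul, map_add, hpK, add_zero]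
  simp only [this, fun k => (hw k).kernel_integral (hK k) (h0 k) fun j => hj j k]
  rw [Finset.sum_add_distrib, Finset.sum_sub_distrib, Finset.sum_comm]
  simp only [ladderIntegral, Finset.mul_sum]

theorem degree_derivative_lt_of_le {K : ℂ[X]} {m : ℕ} (h : K.degree < ((m + 1 : ℕ) : WithBot ℕ)) :
    K.derivative.degree < (m : WithBot ℕ) := by
  rcases eq_or_ne K 0 with rfl | hK
  · simp
  · exact (degree_derivative_lt hK).trans_le (Order.lt_succ_iff.1 (by exact_mod_cast h))

theorem degree_derivative_lt_of_lt {K : ℂ[X]} {m : ℕ} (h : K.degree < (m : WithBot ℕ)) :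
    K.derivative.degree < (m : WithBot ℕ) :=
  degree_derivative_le.trans_lt h

theorem recurrenceCoeff_eq (hm : ∀ k, ∀ m : ℕ, CurveIntegrable (γ k) (fun t => t ^ m * w k t))
    (P : (Fin r → ℕ) → ℂ[X]) (n : Fin r → ℕ) (j : Fin r) (hj : n j ≠ 0) :
    recurrenceCoeff γ w P n j = momentFunctional (hm j) (P n * X ^ n j) /
      momentFunctional (hm j) (P (n - Pi.single j 1) * X ^ (n j - 1)) := by
  rw [recurrenceCoeff, if_neg hj]
  congr 1 <;> exact (momentFunctional_eq _ fun t => by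
    rw [eval_mul, eval_pow, eval_X, mul_comm (eval t _)]).symm

/-! ### The lowering and raising equations and the ladder matrix -/

section Ladder

variable {P : (Fin r → ℕ) → ℂ[X]} {A : (Fin r → ℕ) → Fin r → ℂ[X]} {n : Fin r → ℕ} {x : ℂ}

/-- `P n` is orthogonal to every `K k` and its derivative, so no term with `v_k'(x)` survives. -/
theorem lowering_equation (hw : ∀ k, IsVanishingWeight (γ k) (w k) (v k) (v' k))
    (hPA : IsBiorthogonal (fun k => momentFunctional (hw k).moments) P A)
    (h : ∀ j, LadderIntegrable γ w v' (P n) (raised A n j) x) :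
    (P n).derivative.eval x = (P n).eval x * ladderIntegral γ w v' (P n) (A n) x -
      ∑ j, recurrenceCoeff γ w P n j * (lowered P n (some j)).eval x *
        ladderIntegral γ w v' (P n) (A (n + Pi.single j 1)) x := by
  obtain ⟨K, hK, hKx⟩ := exists_reproducing (hPA.normal n) x
  have hCD := hPA.christoffel_darboux hK hKx
    (recurrenceCoeff_eq (fun k => (hw k).moments) P n)
  rw [derivative_eval_eq hw hKx hCD ?_ (fun k => ?_) (h none) fun j => h (some j)]
  · rw [add_eq_left]
    refine Finset.sum_eq_zero fun k _ => ?_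
    rw [hPA.map_mul_eq_zero n k (hK k), mul_zero]
  · rw [← hPA.degree_eq n]
    exact degree_derivative_lt (hPA.monic n).ne_zero
  · exact hPA.map_mul_eq_zero n k (degree_derivative_lt_of_lt (hK k))

/-- `P_{n-e_i}` has one orthogonality condition fewer, against the `i`-th measure. Hence `∫
P_{n-e_i} K_i dμ_i` need not vanish; the reproducing property gives it the value `P_{n-e_i}(x)`, the
source of the diagonal term `v_i'(x)`. -/
theorem raising_equation (hw : ∀ k, IsVanishingWeight (γ k) (w k) (v k) (v' k))
    (hPA : IsBiorthogonal (fun k => momentFunctional (hw k).moments) P A) (i : Fin r)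
    (h : ∀ j, LadderIntegrable γ w v' (lowered P n (some i)) (raised A n j) x) :
    (lowered P n (some i)).derivative.eval x =
      (P n).eval x * ladderIntegral γ w v' (lowered P n (some i)) (A n) x -
        ∑ j, (recurrenceCoeff γ w P n j *
            ladderIntegral γ w v' (lowered P n (some i)) (A (n + Pi.single j 1)) x -
              v' i x * (if i = j then 1 else 0)) * (lowered P n (some j)).eval x := by
  -- Here the lowered polynomial is zero by convention, and the diagonal term disappears because it
  -- multiplies that polynomial.
  by_cases hi : n i = 0
  · have h0 : lowered P n (some i) = 0 := if_pos hi
    have hl : ∀ B, ladderIntegral γ w v' (0 : ℂ[X]) B x = 0 := fun B => by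
      simp [ladderIntegral, curveIntegral]
    rw [h0]
    simp only [hl, derivative_zero, eval_zero, mul_zero, zero_sub]
    rw [Finset.sum_eq_zero fun j _ => ?_, neg_zero]
    rcases eq_or_ne i j with rfl | hij
    · rw [h0, eval_zero, mul_zero]
    · simp [hij]
  obtain ⟨K, hK, hKx⟩ := exists_reproducing (hPA.normal n) x
  have hCD := hPA.christoffel_darboux hK hKx
    (recurrenceCoeff_eq (fun k => (hw k).moments) P n)
  have hlow : lowered P n (some i) = P (n - Pi.single i 1) := if_neg hi
  have hdeg : (lowered P n (some i)).degree < ((∑ j, n j : ℕ) : WithBot ℕ) := by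
    have := sum_add_single (n - Pi.single i 1) i
    rw [sub_single_add_single hi] at this
    rw [hlow, hPA.degree_eq, this]
    exact_mod_cast Nat.lt_succ_self _
  have hself : (n - Pi.single i 1 : Fin r → ℕ) i + 1 = n i := by simp; omega
  have hne : ∀ k, k ≠ i → (n - Pi.single i 1 : Fin r → ℕ) k = n k := fun k hk => by simp [hk]
  have hoff : ∀ k, k ≠ i →
      momentFunctional (hw k).moments (lowered P n (some i) * K k) = 0 := fun k hk => by
    rw [hlow]
    exact hPA.map_mul_eq_zero _ k ((hK k).trans_eq (congrArg _ (hne k hk).symm))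
  have hrep := hKx _ hdeg
  rw [pairing_apply, Finset.sum_eq_single i (fun k _ hk => hoff k hk)
    (fun hi => absurd (Finset.mem_univ i) hi)] at hrep
  rw [derivative_eval_eq hw hKx hCD (degree_derivative_lt_of_lt hdeg) (fun k => ?_) (h none)
    fun j => h (some j)]
  · have hlast : ∑ k, v' k x * momentFunctional (hw k).moments (lowered P n (some i) * K k) =
        v' i x * (lowered P n (some i)).eval x := by
      rw [Finset.sum_eq_single i (fun k _ hk => by rw [hoff k hk, mul_zero])
        (fun hi => absurd (Finset.mem_univ i) hi), hrep]
    rw [hlast]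
    simp only [sub_mul, Finset.sum_sub_distrib, mul_ite, mul_one, mul_zero, ite_mul, zero_mul,
      Finset.sum_ite_eq, Finset.mem_univ, if_true]
    simp only [mul_right_comm _ _ (ladderIntegral γ w v' _ _ x)]
    ring
  · rw [hlow]
    refine hPA.map_mul_eq_zero _ k ?_
    rcases eq_or_ne k i with rfl | hk
    -- Differentiation lowers the degree bound from `n i` to `n i - 1`, exactly the range in which
    -- `P_{n-e_i}` is orthogonal.
    · exact degree_derivative_lt_of_le ((hK k).trans_eq (congrArg _ hself.symm))
    · exact (degree_derivative_lt_of_lt (hK k)).trans_eq (congrArg _ (hne k hk).symm)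

theorem ladderMatrix_none (i : Option (Fin r)) :
    ladderMatrix γ w v' P A n x i none = ladderIntegral γ w v' (lowered P n i) (A n) x := rfl

/-- The denominator is `t - x` in the matrix and `x - t` in the ladder integrals, hence the sign. -/
theorem ladderMatrix_some (i : Option (Fin r)) (j : Fin r) :
    ladderMatrix γ w v' P A n x i (some j) = -(recurrenceCoeff γ w P n j *
      ladderIntegral γ w v' (lowered P n i) (A (n + Pi.single j 1)) x) +
      (if i = some j then v' j x else 0) := by
  have : ∀ k, curveIntegral (γ k) (fun t => (lowered P n i).eval t *
      ((A (n + Pi.single j 1) k).eval t * ((v' k t - v' k x) / (t - x)) * w k t)) =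
      -curveIntegral (γ k) (fun t => (lowered P n i).eval t *
      ((A (n + Pi.single j 1) k).eval t * ((v' k t - v' k x) / (x - t)) * w k t)) := fun k => by
    rw [curveIntegral, curveIntegral, ← integral_neg]
    refine integral_congr_ae (.of_forall fun s => ?_)
    beta_reduce
    rw [← neg_sub x (γ k s), div_neg]
    ring
  rw [ladderMatrix, Matrix.of_apply, ladderIntegral, ← mul_neg, ← Finset.sum_neg_distrib]
  simp only [this]

end Ladder

end MultipleOrthogonal

theorem theorem2p1 (r : ℕ) (γ : Fin r → ℝ → ℂ) (w v v' : Fin r → ℂ → ℂ)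
    (hw : ∀ k, IsVanishingWeight (γ k) (w k) (v k) (v' k))
    (hnormal : ∀ m : Fin r → ℕ, IsNormalIndex γ w m)
    (P : (Fin r → ℕ) → ℂ[X]) (hP : ∀ m, IsTypeII γ w m (P m))
    (A : (Fin r → ℕ) → Fin r → ℂ[X]) (hA : ∀ m, IsTypeI γ w m (A m))
    (n : Fin r → ℕ)
    (hindep : LinearIndependent ℂ (fun q : (k : Fin r) × Fin (n k) =>
      (Set.range (γ q.1)).indicator (fun z : ℂ => z ^ (q.2 : ℕ) * w q.1 z)))
    (x : ℂ) :
    -- the lowering equation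
    ((∀ j, LadderIntegrable γ w v' (P n) (raised A n j) x) →
      (P n).derivative.eval x =
        (P n).eval x * ladderIntegral γ w v' (P n) (A n) x -
          ∑ j, recurrenceCoeff γ w P n j * (lowered P n (some j)).eval x *
            ladderIntegral γ w v' (P n) (A (n + Pi.single j 1)) x) ∧
    -- the raising equations
    (∀ i : Fin r, (∀ j, LadderIntegrable γ w v' (lowered P n (some i)) (raised A n j) x) →
      (lowered P n (some i)).derivative.eval x =
        (P n).eval x * ladderIntegral γ w v' (lowered P n (some i)) (A n) x -
          ∑ j, (recurrenceCoeff γ w P n j *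
              ladderIntegral γ w v' (lowered P n (some i)) (A (n + Pi.single j 1)) x -
                v' i x * (if i = j then 1 else 0)) *
            (lowered P n (some j)).eval x) ∧
    -- the matrix form
    ((∀ i j, LadderIntegrable γ w v' (lowered P n i) (raised A n j) x) →
      (fun i => (lowered P n i).derivative.eval x) =
        (ladderMatrix γ w v' P A n x).mulVec (fun i => (lowered P n i).eval x)) := by
  have hPA := isBiorthogonal_momentFunctional (fun k => (hw k).moments) hnormal hP hA
  refine ⟨lowering_equation hw hPA, raising_equation hw hPA, fun h => funext fun i => ?_⟩
  rw [Matrix.mulVec, dotProduct, Fintype.sum_option]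
  simp only [ladderMatrix_none, ladderMatrix_some]
  rw [mul_comm, show lowered P n none = P n from rfl]
  cases i with
  | none =>
    refine (lowering_equation hw hPA (h none)).trans ?_
    rw [sub_eq_add_neg, ← Finset.sum_neg_distrib]
    refine congrArg₂ (· + ·) rfl (Finset.sum_congr rfl fun j _ => ?_)
    rw [if_neg (by simp), show lowered P n none = P n from rfl]
    ring
  | some i =>
    refine (raising_equation hw hPA i (h (some i))).trans ?_
    rw [sub_eq_add_neg, ← Finset.sum_neg_distrib]
    refine congrArg₂ (· + ·) rfl (Finset.sum_congr rfl fun j _ => ?_)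
    rcases eq_or_ne i j with rfl | hij
    · simp only [if_true]
      ring
    · rw [if_neg hij, if_neg (by simpa using hij)]
      ring
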